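/- Let $p_i$ denote the $i$th prime ($p_1=2$, $p_2=3$, $\dots$), and let $H$ be the Matula height function, that is, the unique completely additive function from the positive integers to the non-negative integers ($H(ab)=H(a)+H(b)$ for all $a,b\ge 1$) such that $H(p_i)=H(i)+1$ for all $i\ge 1$. Then for every integer $n\ge 3$ the set $\{m\ge 1 : H(m)=n\}$ of numbers at height $n$ has a largest element, and it is $$p_{p_{\cdots_{p_8}}},$$ the result of applying the function $i\mapsto p_i$ exactly $n-3$ times to $8$ (so it is $8$ for $n=3$, $p_8=19$ for $n=4$, $p_{p_8}=67$ for $n=5$, and so on). -/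

import Mathlib

/-- The nth-prime function `i ↦ p_i`, indexed so that `p_1 = 2`, `p_2 = 3`, `p_3 = 5`, ....
(Mathlib's `Nat.nth Nat.Prime` starts counting at `0`. Only indices `i ≥ 1` are meaningful.) -/
noncomputable def nthPrime (i : ℕ) : ℕ := Nat.nth Nat.Prime (i - 1)

theorem primeCounting_lt_self {p : ℕ} (hp : p.Prime) : Nat.primeCounting p < p := by
  have h1 := Nat.primeCounting'_nth_eq (Nat.primeCounting' p)
  have h2 := Nat.add_two_le_nth_prime (Nat.primeCounting' p)
  have h3 : Nat.nth Nat.Prime (Nat.primeCounting' p) = p := Nat.nth_count hp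
  have h4 : Nat.primeCounting p = Nat.primeCounting' p + 1 := by
    unfold Nat.primeCounting Nat.primeCounting'
    rw [Nat.count_succ, if_pos hp]
  omega

theorem primeCounting_nthPrime {i : ℕ} (hi : 0 < i) : Nat.primeCounting (nthPrime i) = i := by
  have hp : Nat.Prime (nthPrime i) := Nat.prime_nth_prime _
  have h4 : Nat.primeCounting (nthPrime i) = Nat.primeCounting' (nthPrime i) + 1 := by
    unfold Nat.primeCounting Nat.primeCounting'
    rw [Nat.count_succ, if_pos hp]
  have h5 : Nat.primeCounting' (nthPrime i) = i - 1 := Nat.primeCounting'_nth_eq _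
  omega

theorem nthPrime_primeCounting {p : ℕ} (hp : p.Prime) : nthPrime (Nat.primeCounting p) = p := by
  have h4 : Nat.primeCounting p = Nat.primeCounting' p + 1 := by
    unfold Nat.primeCounting Nat.primeCounting'
    rw [Nat.count_succ, if_pos hp]
  rw [nthPrime, h4, Nat.add_sub_cancel]
  exact Nat.nth_count hp

/-- The Matula height function: the completely additive function `H` on the positive integers with
`H(p_i) = H(i) + 1`. Every prime `p` in the factorization of `n`, counted with multiplicity,
contributes `H(i) + 1`, where `i = π(p)` is the index of `p` in the sequence of primes.
(The value at `0` is a junk value.) -/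
def matulaHeight (n : ℕ) : ℕ :=
  (n.primeFactorsList.attach.map fun p => matulaHeight (Nat.primeCounting p.1) + 1).sum
termination_by n
decreasing_by
  have hp := Nat.prime_of_mem_primeFactorsList p.2
  exact (primeCounting_lt_self hp).trans_le (Nat.le_of_mem_primeFactorsList p.2)

theorem matulaHeight_eq (n : ℕ) :
    matulaHeight n =
      (n.primeFactorsList.map fun p => matulaHeight (Nat.primeCounting p) + 1).sum := by
  rw [matulaHeight]
  exact congrArg List.sum
    (List.attach_map_val (l := n.primeFactorsList)
      (f := fun p => matulaHeight (Nat.primeCounting p) + 1))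

theorem matulaHeight_one : matulaHeight 1 = 0 := by
  rw [matulaHeight_eq]; simp

theorem matulaHeight_mul {a b : ℕ} (ha : 0 < a) (hb : 0 < b) :
    matulaHeight (a * b) = matulaHeight a + matulaHeight b := by
  rw [matulaHeight_eq (a * b), matulaHeight_eq a, matulaHeight_eq b, ← List.sum_append,
    ← List.map_append]
  exact ((Nat.perm_primeFactorsList_mul ha.ne' hb.ne').map _).sum_eq

theorem matulaHeight_nthPrime {i : ℕ} (hi : 0 < i) :
    matulaHeight (nthPrime i) = matulaHeight i + 1 := by
  have hp : Nat.Prime (nthPrime i) := Nat.prime_nth_prime _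
  rw [matulaHeight_eq, Nat.primeFactorsList_prime hp]
  have h := primeCounting_nthPrime hi
  simp [h]

/-- `matulaHeight` is the only completely additive function with `H(p_i) = H(i) + 1`. -/
theorem matulaHeight_unique (H : ℕ → ℕ)
    (hmul : ∀ a b : ℕ, 0 < a → 0 < b → H (a * b) = H a + H b)
    (hprime : ∀ i : ℕ, 0 < i → H (nthPrime i) = H i + 1) :
    ∀ n : ℕ, 0 < n → H n = matulaHeight n := by
  intro n
  induction n using Nat.strong_induction_on with
  | _ n ih =>
    intro hn
    by_cases h1 : n = 1
    · subst h1
      have := hmul 1 1 one_pos one_pos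
      rw [matulaHeight_one]
      simpa using this
    · have hp : n.minFac.Prime := Nat.minFac_prime h1
      by_cases hnp : n.Prime
      · have h2 := primeCounting_lt_self hnp
        have h3 := nthPrime_primeCounting hnp
        have h4 : 0 < Nat.primeCounting n := by
          unfold Nat.primeCounting Nat.primeCounting'
          rw [Nat.count_succ, if_pos hnp]
          omega
        rw [← h3, hprime _ h4, matulaHeight_nthPrime h4, ih _ h2 h4]
      · obtain ⟨b, hb⟩ := Nat.minFac_dvd n
        have hb0 : 0 < b := by
          rcases Nat.eq_zero_or_pos b with h | h
          · subst h; omega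
          · exact h
        have hlt : n.minFac < n := lt_of_le_of_ne (Nat.minFac_le hn) fun h => hnp (h ▸ hp)
        have hblt : b < n := by
          have := hp.two_le
          nlinarith
        rw [hb, hmul _ _ hp.pos hb0, matulaHeight_mul hp.pos hb0, ih _ hlt hp.pos, ih _ hblt hb0]

/-! Let `M` be `maxAtHeight`, the claimed maximum extended by 1, 2, 4 at heights 0, 1, 2. The bound
`m ≤ M (H m)` follows by strong induction on `m`: primes need `p_{M(n)} ≤ M(n+1)`, and composites
need supermultiplicativity, `M(a) M(b) ≤ M(a+b)` (`maxAtHeight_mul_le`).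

The latter is proved by induction on the smaller index. With `x = M(a)` and `q = M(c+1) = p_{M(c)}`,
one wants `xq ≤ p_{M(a+c)}`, and `π(xq) < x π(q) = M(a) M(c) ≤ M(a+c)` suffices. The first
inequality (`primeCounting_mul_lt`) says that primes thin out; it comes from explicit Chebyshev
bounds once `q ≥ 2^14`. Smaller indices are handled by the growth of `M` by factors 2 and 4. -/

/-! ### Chebyshev-type upper bound for the primorial -/

/-- Kummer's theorem for a carry out of the lowest base-`p` digit. -/
theorem dvd_choose_of_le_mod_add_mod {p n k : ℕ} (hp : p.Prime) (hkn : k ≤ n)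
    (h : p ≤ k % p + (n - k) % p) : p ∣ n.choose k := by
  have hfac := Nat.factorization_choose hp hkn (Nat.lt_add_of_pos_right (n := Nat.log p n) two_pos)
  refine Nat.dvd_of_factorization_pos ?_
  rw [hfac]
  refine (Finset.card_pos.2 ⟨1, ?_⟩).ne'
  simp only [Finset.mem_filter, Finset.mem_Ico, pow_one]
  exact ⟨⟨le_rfl, by omega⟩, h⟩

/-- The product is the multinomial `(6m)! / ((3m)! (2m)! m!)`. In each range of `p`, one of the
additions `3m + 3m` and `m + 2m` carries. -/
theorem dvd_choose_mul_choose {p m : ℕ} (hp : p.Prime) (h1 : m < p) (h2 : p ≤ 6 * m) :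
    p ∣ (6 * m).choose (3 * m) * (3 * m).choose m := by
  have mod_one : ∀ a, p ≤ a → a < 2 * p → a % p = a - p := fun a ha hb => by
    rw [Nat.mod_eq_sub_mod ha, Nat.mod_eq_of_lt (by omega)]
  have e6 : 6 * m - 3 * m = 3 * m := by omega
  have e3 : 3 * m - m = 2 * m := by omega
  rcases lt_or_ge (3 * m) p with h | h
  · refine Dvd.dvd.mul_right (dvd_choose_of_le_mod_add_mod hp (by omega) ?_) _
    rw [e6, Nat.mod_eq_of_lt h]; omega
  rcases lt_or_ge (2 * m) p with h' | h'
  · refine Dvd.dvd.mul_left (dvd_choose_of_le_mod_add_mod hp (by omega) ?_) _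
    rw [e3, Nat.mod_eq_of_lt h1, Nat.mod_eq_of_lt h']; omega
  rcases lt_or_ge (3 * m) (2 * p) with h'' | h''
  · refine Dvd.dvd.mul_right (dvd_choose_of_le_mod_add_mod hp (by omega) ?_) _
    rw [e6, mod_one _ h h'']; omega
  · refine Dvd.dvd.mul_left (dvd_choose_of_le_mod_add_mod hp (by omega) ?_) _
    rw [e3, Nat.mod_eq_of_lt h1, mod_one _ h' (by omega)]; omega

theorem choose_mul_choose_le (m : ℕ) :
    (6 * m).choose (3 * m) * (3 * m).choose m ≤ 432 ^ m := by
  have h1 : (6 * m).choose (3 * m) ≤ 64 ^ m := by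
    calc (6 * m).choose (3 * m) = (2 * (3 * m)).choose (3 * m) := by congr 1; ring
      _ = (3 * m).centralBinom := rfl
      _ ≤ 4 ^ (3 * m) := Nat.centralBinom_le_four_pow _
      _ = 64 ^ m := by rw [pow_mul]; norm_num
  -- A single term of the expansion of `(1 + 2) ^ (3m)`.
  have h2 : (3 * m).choose m * 4 ^ m ≤ 27 ^ m := by
    have h := add_pow 1 2 (3 * m)
    have h' : 1 ^ m * 2 ^ (3 * m - m) * (3 * m).choose m ≤ (1 + 2) ^ (3 * m) := by
      rw [h]
      exact Finset.single_le_sum (f := fun k => 1 ^ k * 2 ^ (3 * m - k) * (3 * m).choose k)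
        (fun _ _ => Nat.zero_le _) (Finset.mem_range.2 (by omega))
    have e : 3 * m - m = 2 * m := by omega
    rw [e, pow_mul, pow_mul] at h'
    norm_num at h'
    linarith
  have h3 : 432 ^ m * 4 ^ m = 64 ^ m * 27 ^ m := by rw [← mul_pow, ← mul_pow]; norm_num
  refine Nat.le_of_mul_le_mul_right ?_ (pow_pos (by norm_num : 0 < 4) m)
  rw [h3, mul_assoc]
  exact Nat.mul_le_mul h1 h2

theorem primorial_six_mul_le (m : ℕ) : primorial (6 * m) ≤ primorial m * 432 ^ m := by
  have e : 6 * m = m + 5 * m := by ring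
  rw [e, primorial_add, ← e]
  refine Nat.mul_le_mul_left _ (le_trans (Nat.le_of_dvd ?_ ?_) (choose_mul_choose_le m))
  · exact Nat.mul_pos (Nat.choose_pos (by omega)) (Nat.choose_pos (by omega))
  · refine Finset.prod_primes_dvd _ (fun p hp => ?_) fun p hp => ?_
    · exact (Finset.mem_filter.1 hp).2.prime
    · obtain ⟨h, hp⟩ := Finset.mem_filter.1 hp
      rw [Finset.mem_Ico] at h
      exact dvd_choose_mul_choose hp (by omega) (by omega)

theorem primorial_succ_of_not_prime {n : ℕ} (h : ¬ (n + 1).Prime) :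
    primorial (n + 1) = primorial n := by
  rw [primorial, Finset.range_add_one, Finset.filter_insert, if_neg h, primorial]

theorem primorial_succ_le (n : ℕ) : primorial (n + 1) ≤ primorial n * (n + 1) := by
  by_cases h : (n + 1).Prime
  · rw [primorial, Finset.range_add_one, Finset.filter_insert, if_pos h,
      Finset.prod_insert (by simp), mul_comm, primorial]
  · rw [primorial_succ_of_not_prime h]
    exact Nat.le_mul_of_pos_right _ n.succ_pos

/-- Only `6m + 1` and `6m + 5` are coprime to 6. -/
theorem primorial_six_mul_add_five_le {m : ℕ} (hm : 0 < m) :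
    primorial (6 * m + 5) ≤ primorial (6 * m) * ((6 * m + 1) * (6 * m + 5)) := by
  have two : ∀ k, ¬ (2 * (k + 2)).Prime := fun k =>
    Nat.not_prime_mul (by norm_num) (by omega)
  have three : ¬ (3 * (2 * m + 1)).Prime := Nat.not_prime_mul (by norm_num) (by omega)
  obtain ⟨k, rfl⟩ := Nat.exists_eq_add_of_le' hm
  have h2 : primorial (6 * (k + 1) + 2) = primorial (6 * (k + 1) + 1) :=
    primorial_succ_of_not_prime (by have := two (3 * k + 2); ring_nf at this ⊢; exact this)
  have h3 : primorial (6 * (k + 1) + 3) = primorial (6 * (k + 1) + 2) :=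
    primorial_succ_of_not_prime (by have := three; ring_nf at this ⊢; exact this)
  have h4 : primorial (6 * (k + 1) + 4) = primorial (6 * (k + 1) + 3) :=
    primorial_succ_of_not_prime (by have := two (3 * k + 3); ring_nf at this ⊢; exact this)
  calc primorial (6 * (k + 1) + 5) ≤ primorial (6 * (k + 1) + 4) * (6 * (k + 1) + 5) :=
        primorial_succ_le _
    _ = primorial (6 * (k + 1) + 1) * (6 * (k + 1) + 5) := by rw [h4, h3, h2]
    _ ≤ primorial (6 * (k + 1)) * (6 * (k + 1) + 1) * (6 * (k + 1) + 5) :=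
        Nat.mul_le_mul_right _ (primorial_succ_le _)
    _ = _ := by ring

theorem pow_four_mul_three_pow_le {m : ℕ} (hm : 90 ≤ m) : (6 * m + 5) ^ 4 * 3 ^ m ≤ 4 ^ m := by
  induction m, hm using Nat.le_induction with
  | base => norm_num
  | succ m hm ih =>
    have h : (6 * (m + 1) + 5) ^ 4 * 3 ≤ (6 * m + 5) ^ 4 * 4 := by
      have h1 : 19 * (6 * (m + 1) + 5) ≤ 20 * (6 * m + 5) := by omega
      have h2 := Nat.pow_le_pow_left h1 4
      rw [mul_pow, mul_pow] at h2
      omega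
    calc (6 * (m + 1) + 5) ^ 4 * 3 ^ (m + 1) = (6 * (m + 1) + 5) ^ 4 * 3 * 3 ^ m := by
          rw [pow_succ 3 m]; ring
      _ ≤ (6 * m + 5) ^ 4 * 4 * 3 ^ m := Nat.mul_le_mul_right _ h
      _ = (6 * m + 5) ^ 4 * 3 ^ m * 4 := by ring
      _ ≤ 4 ^ m * 4 := Nat.mul_le_mul_right _ ih
      _ = _ := (pow_succ _ _).symm

/-- Recursion from `m` to `6m + r`. Since `12^5 = 432^2 * 4/3`, there is a spare factor `(4/3)^m` to
absorb the polynomial loss `(6m + 5)^4`. -/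
theorem primorial_sq_le_mul_twelve_pow {C : ℝ} (hC : (4 / 3) ^ 546 ≤ C) (n : ℕ) :
    (primorial n : ℝ) ^ 2 ≤ C * 12 ^ n := by
  have hC0 : 0 ≤ C := le_trans (by positivity) hC
  induction n using Nat.strong_induction_on with
  | _ n ih =>
    rcases lt_or_ge n 546 with hn | hn
    · have h1 : (primorial n : ℝ) ≤ 4 ^ n := by exact_mod_cast primorial_le_four_pow n
      calc (primorial n : ℝ) ^ 2 ≤ (4 ^ n) ^ 2 := by gcongr
        _ = (4 / 3) ^ n * 12 ^ n := by rw [← pow_mul, mul_comm n, pow_mul, ← mul_pow]; norm_num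
        _ ≤ C * 12 ^ n := by
          gcongr
          exact (pow_le_pow_right₀ (by norm_num) hn.le).trans hC
    · obtain ⟨m, r, hr, rfl⟩ : ∃ m r, r < 6 ∧ n = 6 * m + r :=
        ⟨n / 6, n % 6, Nat.mod_lt _ (by norm_num), by omega⟩
      have hm : 90 ≤ m := by omega
      have h1 : (primorial (6 * m + r) : ℝ) ≤
          primorial m * 432 ^ m * (6 * m + 5) ^ 2 := by
        have h := primorial_six_mul_add_five_le (m := m) (by omega)
        have h' : primorial (6 * m + r) ≤ primorial (6 * m + 5) := primorial_mono (by omega)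
        have : primorial (6 * m + r) ≤ primorial m * 432 ^ m * (6 * m + 5) ^ 2 := by
          refine (h'.trans h).trans (Nat.mul_le_mul (primorial_six_mul_le m) ?_)
          rw [sq]
          exact Nat.mul_le_mul_right _ (by omega)
        exact_mod_cast this
      have h2 : (6 * m + 5 : ℝ) ^ 4 ≤ (4 / 3) ^ m := by
        rw [div_pow, le_div_iff₀ (by positivity)]
        exact_mod_cast pow_four_mul_three_pow_le hm
      have h3 : (12 : ℝ) ^ (6 * m) = 12 ^ m * (186624 ^ m * (4 / 3) ^ m) := by
        rw [← mul_pow, ← mul_pow, pow_mul]; norm_num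
      calc (primorial (6 * m + r) : ℝ) ^ 2
          ≤ (primorial m * 432 ^ m * (6 * m + 5) ^ 2) ^ 2 := by gcongr
        _ = (primorial m : ℝ) ^ 2 * (186624 ^ m * (6 * m + 5) ^ 4) := by
          rw [show (186624 : ℝ) = 432 ^ 2 by norm_num, ← pow_mul]; ring
        _ ≤ C * 12 ^ m * (186624 ^ m * (4 / 3) ^ m) := by
          have := ih m (by omega)
          gcongr
        _ = C * 12 ^ (6 * m) := by rw [h3]; ring
        _ ≤ C * 12 ^ (6 * m + r) := by
          gcongr
          · norm_num
          · omega

/-! ### Explicit bounds for `θ` and `π` -/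

theorem log_twelve_lt : Real.log 12 < 2.496 := by
  have h : 5 * Real.log 12 ≤ 18 * Real.log 2 := by
    have := Real.log_le_log (by norm_num) (by norm_num : (12 : ℝ) ^ 5 ≤ 2 ^ 18)
    rw [Real.log_pow, Real.log_pow] at this
    exact_mod_cast this
  linarith [Real.log_two_lt_d9]

theorem theta_le_mul {x : ℝ} (hx : 22100 ≤ x) : Chebyshev.theta x ≤ 1.2525 * x := by
  have h := primorial_sq_le_mul_twelve_pow le_rfl ⌊x⌋₊
  have hpos : (0 : ℝ) < primorial ⌊x⌋₊ := by exact_mod_cast primorial_pos _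
  have h1 := Real.log_le_log (by positivity) h
  rw [Real.log_mul (by positivity) (by positivity), Real.log_pow, Real.log_pow, Real.log_pow] at h1
  have h2 : Real.log (4 / 3) ≤ 4 / 3 - 1 := Real.log_le_sub_one_of_pos (by norm_num)
  have h3 : (⌊x⌋₊ : ℝ) * Real.log 12 ≤ x * 2.496 :=
    mul_le_mul (Nat.floor_le (by linarith)) log_twelve_lt.le (Real.log_nonneg (by norm_num))
      (by linarith)
  rw [Chebyshev.theta_eq_log_primorial]
  push_cast at h1
  linarith

/-- The threshold 22100 is just above `e^10`. -/
theorem ten_le_log {x : ℝ} (hx : 22100 ≤ x) : 10 ≤ Real.log x := by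
  rw [Real.le_log_iff_exp_le (by linarith)]
  refine le_trans ?_ hx
  have h : Real.exp 10 = Real.exp 1 ^ 10 := by rw [← Real.exp_nat_mul]; norm_num
  rw [h]
  refine (pow_le_pow_left₀ (Real.exp_pos 1).le Real.exp_one_lt_d9.le 10).trans (by norm_num)

theorem hasDerivAt_div_log_sq {t : ℝ} (ht : 1 < t) :
    HasDerivAt (fun t => t / Real.log t ^ 2)
      (1 / Real.log t ^ 2 - 2 / Real.log t ^ 3) t := by
  have h0 : t ≠ 0 := by positivity
  have hl : Real.log t ≠ 0 := (Real.log_pos ht).ne'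
  have h := (hasDerivAt_id t).div ((Real.hasDerivAt_log h0).pow 2) (pow_ne_zero 2 hl)
  convert! h using 1
  simp only [id, Pi.pow_apply]
  field_simp
  ring

theorem integrableOn_theta_div {a : ℝ} (ha : 2 ≤ a) (b : ℝ) :
    MeasureTheory.IntegrableOn (fun t => Chebyshev.theta t / (t * Real.log t ^ 2)) (Set.Icc a b) :=
  (Chebyshev.integrableOn_theta_div_id_mul_log_sq b).mono_set (Set.Icc_subset_Icc_left ha)

/-- For `log t ≥ 10` the derivative of `t / log² t` is at least `0.8 / log² t`, and `1.565625 =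
1.2525 / 0.8`. -/
theorem integral_theta_div_le_of_le {b : ℝ} (hb : 22100 ≤ b) :
    ∫ t in (22100 : ℝ)..b, Chebyshev.theta t / (t * Real.log t ^ 2) ≤
      1.565625 * (b / Real.log b ^ 2) := by
  have hder : ∀ t : ℝ, 22100 ≤ t → HasDerivAt (fun t => 1.565625 * (t / Real.log t ^ 2))
      (1.565625 * (1 / Real.log t ^ 2 - 2 / Real.log t ^ 3)) t := fun t ht =>
    (hasDerivAt_div_log_sq (by linarith)).const_mul _
  have h := intervalIntegral.integral_le_sub_of_hasDeriv_right_of_le hb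
    (fun t ht => (hder t ht.1).continuousAt.continuousWithinAt)
    (fun t ht => (hder t ht.1.le).hasDerivWithinAt)
    (integrableOn_theta_div (by norm_num) b) (fun t ht => ?_)
  · refine h.trans (sub_le_self _ ?_)
    positivity
  · have h10 := ten_le_log ht.1.le
    have ht0 : 0 < t := by linarith [ht.1]
    have hl : 0 < Real.log t := by linarith
    calc Chebyshev.theta t / (t * Real.log t ^ 2) ≤ 1.2525 * t / (t * Real.log t ^ 2) := by
          gcongr
          exact theta_le_mul ht.1.le
      _ = 1.565625 * (0.8 / Real.log t ^ 2) := by field_simp; norm_num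
      _ ≤ 1.565625 * (1 / Real.log t ^ 2 - 2 / Real.log t ^ 3) := by
          refine mul_le_mul_of_nonneg_left ?_ (by norm_num)
          have : 2 / Real.log t ^ 3 = (2 / Real.log t) / Real.log t ^ 2 := by
            field_simp
          rw [this, ← sub_div]
          gcongr
          have : 2 / Real.log t ≤ 0.2 := by
            rw [div_le_iff₀ hl]; linarith
          linarith

theorem integral_theta_div_le_small :
    ∫ t in (2 : ℝ)..22100, Chebyshev.theta t / (t * Real.log t ^ 2) ≤ 64000 := by
  have hl := Real.log_two_gt_d9
  have h := intervalIntegral.norm_integral_le_of_norm_le_const (a := 2) (b := 22100)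
    -- The integrand is at most `log 4 / log² 2 = 2 / log 2 < 2.886`.
    (f := fun t => Chebyshev.theta t / (t * Real.log t ^ 2)) (C := 2.886) (fun t ht => ?_)
  · refine (Real.le_norm_self _).trans (h.trans ?_)
    rw [abs_of_nonneg (by norm_num)]; norm_num
  · rw [Set.uIoc_of_le (by norm_num)] at ht
    have ht0 : 0 < t := by linarith [ht.1]
    have hlt : Real.log 2 ≤ Real.log t := Real.log_le_log (by norm_num) ht.1.le
    have hlt0 : 0 < Real.log t := by linarith
    rw [Real.norm_of_nonneg (div_nonneg (Chebyshev.theta_nonneg t) (by positivity)),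
      div_le_iff₀ (by positivity)]
    have h4 : Real.log 4 = 2 * Real.log 2 := by
      rw [show (4 : ℝ) = 2 ^ 2 by norm_num, Real.log_pow]; norm_num
    have h5 := Chebyshev.theta_le_log4_mul_x ht0.le
    have h6 : Real.log 2 ^ 2 ≤ Real.log t ^ 2 := by gcongr
    have h7 : Real.log 4 ≤ 2.886 * Real.log t ^ 2 := by nlinarith
    nlinarith

/-- Partial summation; the three contributions are `1.2525 + 0.005 + 0.0808 < 1.35`. -/
theorem primeCounting_mul_log_le {N : ℕ} (hN : 2 ^ 28 ≤ N) :
    (Nat.primeCounting N : ℝ) * Real.log N ≤ 1.35 * N := by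
  have hN' : (2 : ℝ) ^ 28 ≤ N := by exact_mod_cast hN
  have hN0 : (22100 : ℝ) ≤ N := le_trans (by norm_num) hN'
  have hl2 := Real.log_two_gt_d9
  have hlog2 : Real.log ((2 : ℝ) ^ 28) = 28 * Real.log 2 := by rw [Real.log_pow]; norm_num
  have hlog : 19.4 ≤ Real.log N := by
    have := Real.log_le_log (by norm_num) hN'
    linarith
  have hlogle : Real.log N ≤ 19.5 / 2 ^ 28 * N := by
    have h1 := Real.log_le_sub_one_of_pos (x := (N : ℝ) / 2 ^ 28) (by positivity)
    rw [Real.log_div (by positivity) (by positivity), hlog2] at h1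
    have h2 := Real.log_two_lt_d9
    have h3 : 1 ≤ (N : ℝ) / 2 ^ 28 := by rw [le_div_iff₀ (by norm_num)]; linarith
    have h4 : 19.5 / 2 ^ 28 * (N : ℝ) = 19.5 * (N / 2 ^ 28) := by ring
    rw [h4]
    linarith
  have h := Chebyshev.primeCounting_eq_theta_div_log_add_integral (x := N) (by linarith)
  have hI1 : IntervalIntegrable (fun t => Chebyshev.theta t / (t * Real.log t ^ 2))
      MeasureTheory.volume 2 22100 :=
    (intervalIntegrable_iff_integrableOn_Icc_of_le (by norm_num)).2
      (integrableOn_theta_div le_rfl _)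
  have hI2 : IntervalIntegrable (fun t => Chebyshev.theta t / (t * Real.log t ^ 2))
      MeasureTheory.volume 22100 N :=
    (intervalIntegrable_iff_integrableOn_Icc_of_le hN0).2
      (integrableOn_theta_div (by norm_num) _)
  rw [Nat.floor_natCast, ← intervalIntegral.integral_add_adjacent_intervals hI1 hI2] at h
  have h1 := integral_theta_div_le_small
  have h2 := integral_theta_div_le_of_le hN0
  have h3 := theta_le_mul hN0
  have hl : 0 < Real.log N := by linarith
  have h5 : 1.565625 * ((N : ℝ) / Real.log N ^ 2) * Real.log N ≤ 0.0808 * N := by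
    have : 1.565625 * ((N : ℝ) / Real.log N ^ 2) * Real.log N = 1.565625 * N / Real.log N := by
      field_simp
    rw [this, div_le_iff₀ hl]
    nlinarith
  calc (Nat.primeCounting N : ℝ) * Real.log N
      ≤ (1.2525 * N / Real.log N + (64000 + 1.565625 * (N / Real.log N ^ 2))) * Real.log N := by
        rw [h]; gcongr
    _ = 1.2525 * N + 64000 * Real.log N +
        1.565625 * (N / Real.log N ^ 2) * Real.log N := by field_simp; ring
    _ ≤ 1.35 * N := by
      have : 64000 * (19.5 / 2 ^ 28 * (N : ℝ)) ≤ 0.005 * N := by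
        rw [← mul_assoc]; gcongr; norm_num
      linarith

theorem le_primeCounting_mul_log {q : ℕ} (hq : 2 ^ 14 ≤ q) :
    0.69 * (q : ℝ) ≤ Nat.primeCounting q * Real.log q := by
  have hq' : (2 : ℝ) ^ 14 ≤ q := by exact_mod_cast hq
  have h := Chebyshev.pi_ge q
  rw [div_le_iff₀ (Real.log_pos (by linarith))] at h
  have h1 := Real.log_two_gt_d9
  have h2 := Real.log_two_lt_d9
  have h3 := Real.log_le_sub_one_of_pos (x := ((q : ℝ) + 1) / 2 ^ 14) (by positivity)
  rw [Real.log_div (by positivity) (by positivity), Real.log_pow] at h3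
  push_cast at h3
  nlinarith

/-- The density of the primes up to `x * q` is smaller than the density up to `q`, for `q ≤ x`. -/
theorem primeCounting_mul_lt {x q : ℕ} (hq : 2 ^ 14 ≤ q) (hx : q ≤ x) :
    Nat.primeCounting (x * q) < x * Nat.primeCounting q := by
  have hq' : (2 : ℝ) ^ 14 ≤ q := by exact_mod_cast hq
  have hx' : (q : ℝ) ≤ x := by exact_mod_cast hx
  have hN : 2 ^ 28 ≤ x * q := by nlinarith
  have h1 := primeCounting_mul_log_le hN
  have h2 := le_primeCounting_mul_log hq
  have hlq : 0 < Real.log q := Real.log_pos (by linarith)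
  -- This is where `q ≤ x` enters: the constant 1.35 is halved to 0.675, below 0.69.
  have hlog : 2 * Real.log q ≤ Real.log ((x * q : ℕ) : ℝ) := by
    push_cast
    rw [Real.log_mul (by linarith) (by linarith)]
    have := Real.log_le_log (by linarith) hx'
    linarith
  have h3 : (Nat.primeCounting (x * q) : ℝ) * (2 * Real.log q) ≤ 1.35 * (x * q : ℕ) :=
    le_trans (by gcongr) h1
  push_cast at h3
  have h4 : (Nat.primeCounting (x * q) : ℝ) * Real.log q <
      x * Nat.primeCounting q * Real.log q := by
    have hxq : (0 : ℝ) < x * q := mul_pos (by linarith) (by linarith)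
    have : (x : ℝ) * (0.69 * q) ≤ x * (Nat.primeCounting q * Real.log q) := by gcongr
    nlinarith
  exact_mod_cast lt_of_mul_lt_mul_right h4 hlq.le

/-! ### Elementary estimates for the nth prime -/

theorem nthPrime_le_of_le_primeCounting {k z : ℕ} (hk : 0 < k) (h : k ≤ Nat.primeCounting z) :
    nthPrime k ≤ z :=
  Nat.lt_succ_iff.1 (Nat.nth_lt_of_lt_count
    (show k - 1 < Nat.count Nat.Prime (z + 1) from lt_of_lt_of_le (by omega) h))

theorem lt_nthPrime_of_primeCounting_lt {k z : ℕ} (h : Nat.primeCounting z < k) :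
    z < nthPrime k := by
  by_contra! h'
  have := Nat.monotone_primeCounting h'
  rw [primeCounting_nthPrime (by omega)] at this
  omega

theorem nthPrime_mono : Monotone nthPrime := fun _ _ h =>
  Nat.nth_monotone Nat.infinite_setOfPred_prime (Nat.sub_le_sub_right h 1)

theorem nthPrime_eq_of_primeCounting {p k : ℕ} (hp : p.Prime) (h : Nat.primeCounting p = k) :
    nthPrime k = p := by
  rw [← h, nthPrime_primeCounting hp]

theorem nthPrime_eight : nthPrime 8 = 19 :=
  nthPrime_eq_of_primeCounting (by norm_num) (by decide +kernel)

theorem nthPrime_nineteen : nthPrime 19 = 67 :=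
  nthPrime_eq_of_primeCounting (by norm_num) (by decide +kernel)

theorem primeCounting_331 : Nat.primeCounting 331 = 67 := by decide +kernel

theorem nthPrime_67 : nthPrime 67 = 331 :=
  nthPrime_eq_of_primeCounting (by norm_num) primeCounting_331

theorem two_mul_le_nthPrime {k : ℕ} (hk : 19 ≤ k) : 2 * k ≤ nthPrime k := by
  have h : Nat.primeCounting (2 * k - 1) < k := by
    have h1 := Nat.primeCounting_add_le (a := 6) (k := 25) (by norm_num) (by norm_num) (2 * k - 26)
    rw [show 25 + (2 * k - 26) = 2 * k - 1 by omega,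
      show Nat.primeCounting 25 = 9 by decide +kernel,
      show Nat.totient 6 = 2 by decide +kernel] at h1
    omega
  have := lt_nthPrime_of_primeCounting_lt h
  omega

/-- Sieving by 210 beyond 331 gives enough for these `k`, which cover all values of `maxAtHeight`
from height 6 on. -/
theorem four_mul_le_nthPrime {k : ℕ} (hk : k = 331 ∨ 460 ≤ k) : 4 * k ≤ nthPrime k := by
  have h : Nat.primeCounting (4 * k - 1) < k := by
    have h1 := Nat.primeCounting_add_le (a := 210) (k := 331) (by norm_num) (by norm_num)
      (4 * k - 332)
    rw [show 331 + (4 * k - 332) = 4 * k - 1 by omega, primeCounting_331,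
      show Nat.totient 210 = 48 by decide +kernel] at h1
    omega
  have := lt_nthPrime_of_primeCounting_lt h
  omega

theorem two_pow_le_primeCounting (k : ℕ) :
    2 ^ k ≤ Nat.primeCounting (2 ^ k) * k + k + 1 := by
  have h := Chebyshev.psi_ge (2 ^ k)
  have h' := Chebyshev.psi_le_primeCounting_mul_log (2 ^ k)
  have hl : 0 < Real.log 2 := Real.log_pos (by norm_num)
  have h1 : Real.log ((2 ^ k : ℕ) + 1) ≤ (k + 1) * Real.log 2 := by
    have e : ((k : ℝ) + 1) * Real.log 2 = Real.log (2 ^ (k + 1)) := by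
      rw [Real.log_pow]; push_cast; ring
    rw [e]
    refine Real.log_le_log (by positivity) ?_
    have : (1 : ℝ) ≤ 2 ^ k := one_le_pow₀ (by norm_num)
    push_cast
    rw [pow_succ]
    linarith
  have h2 : Real.log ((2 ^ k : ℕ) : ℝ) = k * Real.log 2 := by push_cast; rw [Real.log_pow]
  rw [h2] at h'
  have h3 : ((2 ^ k : ℕ) : ℝ) * Real.log 2 ≤
      (Nat.primeCounting (2 ^ k) * k + k + 1) * Real.log 2 := by linarith
  exact_mod_cast le_of_mul_le_mul_right h3 hl

/-! ### Growth of the claimed maximum -/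

/-- The claimed largest number of a given height. -/
noncomputable def maxAtHeight : ℕ → ℕ
  | 0 => 1
  | 1 => 2
  | 2 => 4
  | n + 3 => nthPrime^[n] 8

theorem maxAtHeight_four_add (n : ℕ) : maxAtHeight (n + 4) = nthPrime (maxAtHeight (n + 3)) :=
  Function.iterate_succ_apply' _ _ _

theorem maxAtHeight_succ {n : ℕ} (hn : 3 ≤ n) :
    maxAtHeight (n + 1) = nthPrime (maxAtHeight n) := by
  obtain ⟨k, rfl⟩ := Nat.exists_eq_add_of_le' hn
  exact maxAtHeight_four_add k

theorem maxAtHeight_three : maxAtHeight 3 = 8 := rfl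

theorem maxAtHeight_four : maxAtHeight 4 = 19 := by
  rw [maxAtHeight_succ le_rfl, maxAtHeight_three, nthPrime_eight]

theorem maxAtHeight_five : maxAtHeight 5 = 67 := by
  rw [maxAtHeight_succ (by norm_num), maxAtHeight_four, nthPrime_nineteen]

theorem maxAtHeight_six : maxAtHeight 6 = 331 := by
  rw [maxAtHeight_succ (by norm_num), maxAtHeight_five, nthPrime_67]

theorem maxAtHeight_seven_lt : maxAtHeight 7 < 4096 := by
  rw [maxAtHeight_succ (by norm_num), maxAtHeight_six]
  have h := two_pow_le_primeCounting 12
  norm_num at h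
  have hp : (nthPrime 331).Prime := Nat.prime_nth_prime _
  -- Strictness matters: at height 8 the lower bound for `π(2^16)` is exactly 4095.
  refine lt_of_le_of_ne (nthPrime_le_of_le_primeCounting (by norm_num) (by omega)) fun h => ?_
  rw [h] at hp
  norm_num at hp

theorem two_mul_maxAtHeight_le (a : ℕ) : 2 * maxAtHeight a ≤ maxAtHeight (a + 1) := by
  rcases lt_or_ge a 4 with h | h
  · interval_cases a
    · exact le_rfl
    · exact le_rfl
    · exact le_rfl
    · rw [maxAtHeight_four, maxAtHeight_three]; norm_num
  · suffices 19 ≤ maxAtHeight a ∧ 2 * maxAtHeight a ≤ maxAtHeight (a + 1) from this.2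
    induction a, h using Nat.le_induction with
    | base => rw [maxAtHeight_four, maxAtHeight_five]; norm_num
    | succ a ha ih =>
      have h19 : 19 ≤ maxAtHeight (a + 1) := by omega
      refine ⟨h19, ?_⟩
      rw [maxAtHeight_succ (by omega : 3 ≤ a + 1)]
      exact two_mul_le_nthPrime h19

theorem maxAtHeight_mono : Monotone maxAtHeight :=
  monotone_nat_of_le_succ fun a => by have := two_mul_maxAtHeight_le a; omega

theorem maxAtHeight_pos (a : ℕ) : 0 < maxAtHeight a :=
  lt_of_lt_of_le one_pos (maxAtHeight_mono (Nat.zero_le a))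

theorem four_mul_maxAtHeight_le {a : ℕ} (ha : 5 ≤ a) :
    4 * maxAtHeight a ≤ maxAtHeight (a + 1) := by
  rcases ha.eq_or_lt with rfl | h
  · rw [maxAtHeight_five, maxAtHeight_six]; norm_num
  · rw [maxAtHeight_succ (by omega)]
    refine four_mul_le_nthPrime ?_
    rcases (Nat.succ_le_of_lt h).eq_or_lt with rfl | h
    · exact Or.inl maxAtHeight_six
    · have h7 := two_mul_maxAtHeight_le 6
      rw [maxAtHeight_six] at h7
      have := maxAtHeight_mono (show 6 + 1 ≤ a from h)
      omega

theorem two_pow_mul_maxAtHeight_le (a k : ℕ) :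
    maxAtHeight a * 2 ^ k ≤ maxAtHeight (a + k) := by
  induction k with
  | zero => simp
  | succ k ih =>
    have := two_mul_maxAtHeight_le (a + k)
    rw [pow_succ, ← add_assoc]
    linarith

theorem four_pow_mul_maxAtHeight_le {a : ℕ} (ha : 5 ≤ a) (k : ℕ) :
    maxAtHeight a * 4 ^ k ≤ maxAtHeight (a + k) := by
  induction k with
  | zero => simp
  | succ k ih =>
    have := four_mul_maxAtHeight_le (a := a + k) (by omega)
    rw [pow_succ, ← add_assoc]
    linarith

theorem maxAtHeight_le_four_pow {b : ℕ} (h5 : 5 ≤ b) (h8 : b ≤ 8) : maxAtHeight b ≤ 4 ^ b := by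
  have h7 := maxAtHeight_seven_lt
  interval_cases b
  · rw [maxAtHeight_five]; norm_num
  · rw [maxAtHeight_six]; norm_num
  · omega
  · rw [maxAtHeight_succ (by norm_num)]
    have := two_pow_le_primeCounting 16
    norm_num at this ⊢
    exact nthPrime_le_of_le_primeCounting (maxAtHeight_pos 7) (by omega)

/-! ### Supermultiplicativity -/

theorem maxAtHeight_mul_le_of_le {a b : ℕ} (h : b ≤ a) :
    maxAtHeight a * maxAtHeight b ≤ maxAtHeight (a + b) := by
  induction b with
  | zero => simp [maxAtHeight]
  | succ c ih =>
    rcases lt_or_ge c 3 with hc | hc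
    · have hb : maxAtHeight (c + 1) = 2 ^ (c + 1) := by interval_cases c <;> rfl
      rw [hb]
      exact two_pow_mul_maxAtHeight_le _ _
    -- For `b = 4`, one doubling reaches height at least 5, then three quadruplings follow: `19 ≤ 2
    -- * 4^3`.
    rcases hc.eq_or_lt with rfl | hc
    · have h1 := two_mul_maxAtHeight_le a
      have h2 := four_pow_mul_maxAtHeight_le (a := a + 1) (by omega) 3
      rw [show a + 1 + 3 = a + (3 + 1) by ring] at h2
      rw [maxAtHeight_four]
      omega
    rcases lt_or_ge c 8 with hc8 | hc8
    · exact (Nat.mul_le_mul_left _ (maxAtHeight_le_four_pow (by omega) (by omega))).trans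
        (four_pow_mul_maxAtHeight_le (by omega) _)
    -- From height 9 on, `67 * 4^4 = 17152` exceeds `2^14`.
    · have hq : 2 ^ 14 ≤ maxAtHeight (c + 1) := by
        have h9 := four_pow_mul_maxAtHeight_le (le_refl 5) 4
        rw [maxAtHeight_five] at h9
        have := maxAtHeight_mono (by omega : 5 + 4 ≤ c + 1)
        omega
      have hlt := primeCounting_mul_lt hq (maxAtHeight_mono h)
      have hpi : Nat.primeCounting (maxAtHeight (c + 1)) = maxAtHeight c := by
        rw [maxAtHeight_succ (by omega), primeCounting_nthPrime (maxAtHeight_pos c)]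
      rw [hpi] at hlt
      rw [← add_assoc, maxAtHeight_succ (by omega : 3 ≤ a + c)]
      exact (lt_nthPrime_of_primeCounting_lt (hlt.trans_le (ih (by omega)))).le

theorem maxAtHeight_mul_le (a b : ℕ) :
    maxAtHeight a * maxAtHeight b ≤ maxAtHeight (a + b) := by
  rcases le_total b a with h | h
  · exact maxAtHeight_mul_le_of_le h
  · rw [mul_comm, add_comm]
    exact maxAtHeight_mul_le_of_le h

/-! ### Maximality and attainment -/

/-- Below height 3 powers of 2 win: `p_1 = 2`, `p_2 = 3 < 4`, `p_4 = 7 < 8`. From then on equality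
holds by construction. -/
theorem nthPrime_maxAtHeight_le (n : ℕ) : nthPrime (maxAtHeight n) ≤ maxAtHeight (n + 1) := by
  rcases lt_or_ge n 3 with h | h
  · interval_cases n <;>
      exact nthPrime_le_of_le_primeCounting (maxAtHeight_pos _) (by decide +kernel)
  · exact (maxAtHeight_succ h).ge

theorem le_maxAtHeight {m : ℕ} (hm : 0 < m) : m ≤ maxAtHeight (matulaHeight m) := by
  induction m using Nat.strong_induction_on with
  | _ m ih =>
    by_cases h1 : m = 1
    · rw [h1]; exact maxAtHeight_pos _
    by_cases hp : m.Prime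
    · have hpos : 0 < Nat.primeCounting m := by
        rw [Nat.pos_iff_ne_zero, Ne, Nat.primeCounting_eq_zero_iff]
        have := hp.two_le
        omega
      have h := nthPrime_mono (ih _ (primeCounting_lt_self hp) hpos)
      rw [nthPrime_primeCounting hp] at h
      conv_rhs => rw [← nthPrime_primeCounting hp, matulaHeight_nthPrime hpos]
      exact h.trans (nthPrime_maxAtHeight_le _)
    · obtain ⟨a, b, ha, hb, rfl⟩ := (Nat.not_prime_iff_exists_mul_eq (by omega)).1 hp
      have ha0 : 0 < a := Nat.pos_of_mul_pos_right hm
      have hb0 : 0 < b := Nat.pos_of_mul_pos_left hm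
      rw [matulaHeight_mul ha0 hb0]
      exact (Nat.mul_le_mul (ih a ha ha0) (ih b hb hb0)).trans (maxAtHeight_mul_le _ _)

theorem matulaHeight_iterate_nthPrime {m : ℕ} (hm : 0 < m) (k : ℕ) :
    0 < nthPrime^[k] m ∧ matulaHeight (nthPrime^[k] m) = matulaHeight m + k := by
  induction k with
  | zero => exact ⟨hm, rfl⟩
  | succ k ih =>
    rw [Function.iterate_succ_apply', matulaHeight_nthPrime ih.1, ih.2]
    exact ⟨(Nat.prime_nth_prime _).pos, by ring⟩

theorem matulaHeight_eight : matulaHeight 8 = 3 := by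
  have h2 : matulaHeight 2 = 1 := by
    have h := matulaHeight_nthPrime one_pos
    rwa [matulaHeight_one, nthPrime_eq_of_primeCounting Nat.prime_two (by decide +kernel)] at h
  rw [show 8 = 2 * (2 * 2) by norm_num, matulaHeight_mul two_pos (by norm_num),
    matulaHeight_mul two_pos two_pos, h2]

theorem mainTheorem5 (n : ℕ) (hn : 3 ≤ n) :
    IsGreatest {m : ℕ | 0 < m ∧ matulaHeight m = n} (nthPrime^[n - 3] 8) := by
  obtain ⟨k, rfl⟩ := Nat.exists_eq_add_of_le' hn
  rw [Nat.add_sub_cancel]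
  refine ⟨?_, fun m hm => ?_⟩
  · have h := matulaHeight_iterate_nthPrime (m := 8) (by norm_num) k
    rw [matulaHeight_eight, add_comm] at h
    exact h
  · have h := le_maxAtHeight hm.1
    rwa [hm.2] at h
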